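/- Let $\mathsf H$ be a quaternionic Hilbert space: a right $\mathbb H$-module with a Hermitean quaternionic scalar product $\langle\cdot|\cdot\rangle$ (right $\mathbb H$-linear in the second variable, $\langle u|v\rangle=\overline{\langle v|u\rangle}$, $\langle u|u\rangle\ge 0$ with equality only for $u=0$) which is complete for the norm $\|u\|=\sqrt{\langle u|u\rangle}$. Let $\mathfrak B(\mathsf H)$ be the set of bounded right $\mathbb H$-linear operators on $\mathsf H$, with adjoint $T^*$ given by $\langle T^*u|v\rangle=\langle u|Tv\rangle$. An operator $P\in\mathfrak B(\mathsf H)$ is called positive if $\langle u|Pu\rangle$ is a nonnegative real number for all $u$, and $|S|$ denotes the unique positive operator in $\mathfrak B(\mathsf H)$ with $|S|^2=S^*S$. Let $T\in\mathfrak B(\mathsf H)$ be normal ($TT^*=T^*T$), and put $A:=(T+T^*)\tfrac12$ and $B:=|T-T^*|\tfrac12$. 1. There exists $J\in\mathfrak B(\mathsf H)$ that is anti self-adjoint ($J^*=-J$) and unitary ($JJ^*=J^*J=\mathrm I$) such that $TJ=JT$, $T^*J=JT^*$ and $T=A+JB$. 2. $A$ is self-adjoint, $B$ is positive, and for every $J$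 as in 1 the operators $A$, $B$ and $J$ commute mutually. 3. $A$ and $B$ are uniquely determined by $T$: if $A',B',J'\in\mathfrak B(\mathsf H)$ commute mutually, $A'$ is self-adjoint, $B'$ is positive, $J'$ is anti self-adjoint and unitary, and $T=A'+J'B'$, then $A'=A$ and $B'=B$, and $J'$ has the properties in 1. 4. $J$ is uniquely determined by $T$ on $\mathrm{Ker}(T-T^*)^\perp$: if $J$ and $J'$ both have the properties in 1, then $Ju=J'u$ for every $u\in\mathrm{Ker}(T-T^*)^\perp$. -/

import Mathlib

open scoped Quaternion

noncomputable section

/-- A (right) quaternionic inner product space: a right module over the quaternions (that is, a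
module over the opposite ring, `MulOpposite.op q • u` being `u q`) with a Hermitean quaternionic
scalar product `⟨u|v⟩`, right linear in the second variable, whose norm is `√⟨u|u⟩`.
Together with completeness this is a quaternionic Hilbert space. -/
class QuaternionicInnerProductSpace (E : Type*) [NormedAddCommGroup E] extends
    Module ℍ[ℝ]ᵐᵒᵖ E, Inner ℍ[ℝ] E where
  /-- Additivity in the second variable. -/
  inner_add_right : ∀ u v w : E, inner u (v + w) = inner u v + inner u w
  /-- Right homogeneity in the second variable. -/
  inner_smul_right : ∀ (u v : E) (q : ℍ[ℝ]), inner u (MulOpposite.op q • v) = inner u v * q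
  /-- Quaternionic Hermiticity. -/
  star_inner : ∀ u v : E, star (inner v u) = inner u v
  /-- `⟨u|u⟩` is the real number `‖u‖ ^ 2`; positivity and definiteness follow. -/
  inner_self : ∀ u : E, inner u u = ((‖u‖ ^ 2 : ℝ) : ℍ[ℝ])

namespace QuaternionicInnerProductSpace

section Basic

variable {E : Type*} [NormedAddCommGroup E] [QuaternionicInnerProductSpace E]

theorem inner_add_left (u v w : E) : inner ℍ[ℝ] (u + v) w = inner ℍ[ℝ] u w + inner ℍ[ℝ] v w := by
  rw [← star_inner, inner_add_right, star_add, star_inner, star_inner]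

theorem inner_smul_left (u v : E) (q : ℍ[ℝ]) :
    inner ℍ[ℝ] (MulOpposite.op q • u) v = star q * inner ℍ[ℝ] u v := by
  rw [← star_inner, inner_smul_right, star_mul, star_inner]

theorem ext_inner_right {u w : E} (h : ∀ v, inner ℍ[ℝ] u v = inner ℍ[ℝ] w v) : u = w := by
  have hneg : ∀ v : E, inner ℍ[ℝ] (-w) v = -inner ℍ[ℝ] w v := fun v => by
    have := inner_smul_left w v (-1)
    simpa using this
  have h1 : inner ℍ[ℝ] (u - w) (u - w) = 0 := by
    rw [sub_eq_add_neg, inner_add_left, hneg, h]; simp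
  rw [inner_self] at h1
  have h2 : ‖u - w‖ ^ 2 = 0 := Quaternion.coe_injective (h1.trans Quaternion.coe_zero.symm)
  exact sub_eq_zero.1 (by simpa using h2)

theorem norm_op_smul (q : ℍ[ℝ]) (u : E) : ‖MulOpposite.op q • u‖ = ‖q‖ * ‖u‖ := by
  have h := inner_self (MulOpposite.op q • u)
  rw [inner_smul_left, inner_smul_right, inner_self, ← mul_assoc,
    ← (Quaternion.coe_commutes _ (star q)), mul_assoc, Quaternion.star_mul_self,
    Quaternion.normSq_eq_norm_mul_self, ← Quaternion.coe_mul] at h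
  have h' : ‖u‖ ^ 2 * (‖q‖ * ‖q‖) = ‖MulOpposite.op q • u‖ ^ 2 := Quaternion.coe_injective h
  rw [← sq_eq_sq₀ (norm_nonneg _) (by positivity), ← h']
  ring

end Basic

/-! Restriction of scalars to `ℂ`, used only to show that adjoints and square roots exist. -/

section Complex

variable (E : Type*) [NormedAddCommGroup E] [QuaternionicInnerProductSpace E]

/-- The embedding `a + b i ↦ op (a + b i)` of the complex numbers. -/
def complexHom : ℂ →+* ℍ[ℝ]ᵐᵒᵖ :=
  (Quaternion.ofComplex : ℂ →ₐ[ℝ] ℍ[ℝ]).toRingHom.toOpposite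
    (fun x y => by rw [Commute, SemiconjBy, ← map_mul, mul_comm, map_mul])

theorem complexHom_apply (z : ℂ) : complexHom z = MulOpposite.op (z : ℍ[ℝ]) := rfl

/-- The complex normed space underlying a quaternionic inner product space. -/
@[reducible] def complexNormedSpace : NormedSpace ℂ E where
  toModule := Module.compHom E complexHom
  norm_smul_le z u := by
    change ‖MulOpposite.op (z : ℍ[ℝ]) • u‖ ≤ _
    rw [norm_op_smul]
    gcongr
    refine le_of_eq ?_
    rw [← sq_eq_sq₀ (norm_nonneg _) (norm_nonneg _), sq, ← Quaternion.normSq_eq_norm_mul_self,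
      Quaternion.normSq_def', Complex.sq_norm, Complex.normSq_apply]
    simp
    ring

/-- The complex inner product space underlying a quaternionic inner product space. -/
@[reducible] def complexInnerProductSpace : InnerProductSpace ℂ E where
  toNormedSpace := complexNormedSpace E
  inner u v := ⟨(inner ℍ[ℝ] u v).re, (inner ℍ[ℝ] u v).imI⟩
  norm_sq_eq_re_inner u := by rw [inner_self]; exact (Quaternion.re_coe _).symm
  conj_inner_symm u v := by rw [← star_inner u v]; apply Complex.ext <;> simp
  add_left u v w := by rw [inner_add_left]; apply Complex.ext <;> simp
  smul_left u v z := by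
    change (⟨(inner ℍ[ℝ] (MulOpposite.op (z : ℍ[ℝ]) • u) v).re,
      (inner ℍ[ℝ] (MulOpposite.op (z : ℍ[ℝ]) • u) v).imI⟩ : ℂ) = _
    rw [inner_smul_left]
    apply Complex.ext <;> simp

variable {E}

attribute [local instance] complexInnerProductSpace

theorem complex_smul_def (z : ℂ) (u : E) : z • u = MulOpposite.op (z : ℍ[ℝ]) • u := rfl

theorem complex_inner_re (u v : E) : (inner ℂ u v).re = (inner ℍ[ℝ] u v).re := rfl

theorem complex_inner_im (u v : E) : (inner ℂ u v).im = (inner ℍ[ℝ] u v).imI := rfl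

/-- The complex linear operator underlying a right quaternionic linear one. -/
def toComplexOp (T : E →L[ℍ[ℝ]ᵐᵒᵖ] E) : E →L[ℂ] E where
  toFun := T
  map_add' := map_add T
  map_smul' z u := map_smul T (MulOpposite.op (z : ℍ[ℝ])) u
  cont := T.continuous

theorem toComplexOp_apply (T : E →L[ℍ[ℝ]ᵐᵒᵖ] E) (u : E) : toComplexOp T u = T u := rfl

/-- The quaternionic unit `j`. -/
def unitJ : ℍ[ℝ] := ⟨0, 0, 1, 0⟩

theorem unitJ_re : unitJ.re = 0 := rfl

theorem unitJ_imI : unitJ.imI = 0 := rfl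

theorem unitJ_imJ : unitJ.imJ = 1 := rfl

theorem unitJ_imK : unitJ.imK = 0 := rfl

/-- A complex linear operator that commutes with right multiplication by `j` is right
quaternionic linear. -/
def ofComplexOp (S : E →L[ℂ] E)
    (hS : ∀ u, S (MulOpposite.op unitJ • u) = MulOpposite.op unitJ • S u) :
    E →L[ℍ[ℝ]ᵐᵒᵖ] E where
  toFun := S
  map_add' := map_add S
  map_smul' q u := by
    have hq : q = MulOpposite.op (((⟨q.unop.re, q.unop.imI⟩ : ℂ) : ℍ[ℝ]) +
        ((⟨q.unop.imJ, q.unop.imK⟩ : ℂ) : ℍ[ℝ]) * unitJ) := by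
      apply MulOpposite.unop_injective
      ext <;> simp [unitJ_re, unitJ_imI, unitJ_imJ, unitJ_imK]
    rw [hq, MulOpposite.op_add, MulOpposite.op_mul, add_smul, mul_smul, map_add, hS,
      ← complex_smul_def, ← complex_smul_def, map_smul, map_smul]
    simp only [RingHom.id_apply]
    rw [add_smul, mul_smul, ← complex_smul_def, ← complex_smul_def]
  cont := S.continuous

theorem inner_eq_of_re {u v u' v' : E}
    (h : ∀ q : ℍ[ℝ], (inner ℍ[ℝ] u (MulOpposite.op q • v)).re =
      (inner ℍ[ℝ] u' (MulOpposite.op q • v')).re) :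
    inner ℍ[ℝ] u v = inner ℍ[ℝ] u' v' := by
  simp only [inner_smul_right, Quaternion.re_mul] at h
  ext
  · simpa using h 1
  · simpa using h ⟨0, 1, 0, 0⟩
  · simpa using h ⟨0, 0, 1, 0⟩
  · simpa using h ⟨0, 0, 0, 1⟩

theorem inner_complexAdjoint [CompleteSpace E] (T : E →L[ℍ[ℝ]ᵐᵒᵖ] E) (u v : E) :
    inner ℍ[ℝ] (ContinuousLinearMap.adjoint (toComplexOp T) u) v = inner ℍ[ℝ] u (T v) := by
  apply inner_eq_of_re
  intro q
  rw [← complex_inner_re, ContinuousLinearMap.adjoint_inner_left, complex_inner_re,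
    toComplexOp_apply, map_smul]

/-- The adjoint `T*` of a bounded right quaternionic linear operator: see `inner_adjoint_left`. -/
def adjoint [CompleteSpace E] (T : E →L[ℍ[ℝ]ᵐᵒᵖ] E) : E →L[ℍ[ℝ]ᵐᵒᵖ] E :=
  ofComplexOp (ContinuousLinearMap.adjoint (toComplexOp T)) (fun u => by
    apply ext_inner_right
    intro v
    rw [inner_complexAdjoint, inner_smul_left, inner_smul_left, inner_complexAdjoint])

/-- The defining property `⟨T* u|v⟩ = ⟨u|T v⟩` of the adjoint. -/
theorem inner_adjoint_left [CompleteSpace E] (T : E →L[ℍ[ℝ]ᵐᵒᵖ] E) (u v : E) :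
    inner ℍ[ℝ] (adjoint T u) v = inner ℍ[ℝ] u (T v) :=
  inner_complexAdjoint T u v

/-- A bounded operator `T` is positive if `⟨u|T u⟩` is a nonnegative real number for all `u`. -/
def IsPositive (T : E →L[ℍ[ℝ]ᵐᵒᵖ] E) : Prop :=
  ∀ u : E, ∃ r : ℝ, 0 ≤ r ∧ inner ℍ[ℝ] u (T u) = (r : ℍ[ℝ])

theorem toComplexOp_nonneg {T : E →L[ℍ[ℝ]ᵐᵒᵖ] E} (hT : IsPositive T) : 0 ≤ toComplexOp T := by
  rw [ContinuousLinearMap.nonneg_iff_isPositive, ContinuousLinearMap.isPositive_iff_complex]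
  intro u
  obtain ⟨r, hr, h⟩ := hT u
  have h' : inner ℂ (T u) u = (r : ℂ) := by
    apply Complex.ext
    · rw [complex_inner_re, ← star_inner, h]; simp
    · rw [complex_inner_im, ← star_inner, h]; simp
  rw [toComplexOp_apply, h']
  simpa using hr

/-- A bounded positive operator has exactly one bounded positive square root. -/
theorem existsUnique_sqrt [CompleteSpace E] {T : E →L[ℍ[ℝ]ᵐᵒᵖ] E} (hT : IsPositive T) :
    ∃! P : E →L[ℍ[ℝ]ᵐᵒᵖ] E, IsPositive P ∧ P * P = T := by
  have ha := toComplexOp_nonneg hT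
  set S : E →L[ℂ] E := CFC.sqrt (toComplexOp T) with hSdef
  have hS0 : 0 ≤ S := CFC.sqrt_nonneg _
  have hSS : S * S = toComplexOp T := CFC.sqrt_mul_sqrt_self _ ha
  have hjj : ∀ u : E, MulOpposite.op unitJ • MulOpposite.op unitJ • u = -u := fun u => by
    rw [← mul_smul, ← MulOpposite.op_mul]
    have : unitJ * unitJ = -1 := by ext <;> simp [unitJ_re, unitJ_imI, unitJ_imJ, unitJ_imK]
    rw [this]; simp
  have hjz : ∀ (z : ℂ) (u : E), MulOpposite.op unitJ • z • u =
      (starRingEnd ℂ z) • MulOpposite.op unitJ • u := fun z u => by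
    rw [complex_smul_def, complex_smul_def, ← mul_smul, ← mul_smul, ← MulOpposite.op_mul,
      ← MulOpposite.op_mul]
    congr 2
    ext <;> simp [unitJ_re, unitJ_imI, unitJ_imJ, unitJ_imK]
  let S' : E →L[ℂ] E :=
    { toFun := fun u => -(MulOpposite.op unitJ • S (MulOpposite.op unitJ • u))
      map_add' := fun u v => by
        rw [smul_add, map_add, smul_add, neg_add]
      map_smul' := fun z u => by
        rw [hjz, map_smul, hjz, Complex.conj_conj, smul_neg, RingHom.id_apply]
      cont := by
        have hc : Continuous fun u : E => MulOpposite.op unitJ • u :=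
          AddMonoidHomClass.continuous_of_bound
            (DistribSMul.toAddMonoidHom E (MulOpposite.op unitJ)) ‖unitJ‖
            (fun u => (norm_op_smul unitJ u).le)
        exact (hc.comp (S.continuous.comp hc)).neg }
  have hS'apply : ∀ u, S' u = -(MulOpposite.op unitJ • S (MulOpposite.op unitJ • u)) :=
    fun u => rfl
  have hS'0 : 0 ≤ S' := by
    rw [ContinuousLinearMap.nonneg_iff_isPositive,
      ContinuousLinearMap.isPositive_iff_complex] at hS0 ⊢
    intro u
    have h := hS0 (MulOpposite.op unitJ • u)
    have e : inner ℂ (S' u) u =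
        inner ℂ (S (MulOpposite.op unitJ • u)) (MulOpposite.op unitJ • u) := by
      have e1 : inner ℍ[ℝ] (S' u) u =
          unitJ * inner ℍ[ℝ] (S (MulOpposite.op unitJ • u)) u := by
        have : S' u = MulOpposite.op (-unitJ) • S (MulOpposite.op unitJ • u) := by
          rw [hS'apply, MulOpposite.op_neg, neg_smul]
        rw [this, inner_smul_left]
        congr 1
        ext <;> simp [unitJ_re, unitJ_imI, unitJ_imJ, unitJ_imK]
      have him : (inner ℂ (S (MulOpposite.op unitJ • u)) (MulOpposite.op unitJ • u)).im = 0 := by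
        rw [← h.1]; exact Complex.ofReal_im _
      have him' := him
      rw [complex_inner_im, inner_smul_right] at him'
      apply Complex.ext
      · rw [complex_inner_re, complex_inner_re, e1, inner_smul_right]
        simp [unitJ_re, unitJ_imI, unitJ_imJ, unitJ_imK]
      · rw [him, complex_inner_im, e1]
        simpa [unitJ_re, unitJ_imI, unitJ_imJ, unitJ_imK] using him'
    rw [e]
    exact h
  have hS'S' : S' * S' = toComplexOp T := by
    ext u
    change S' (S' u) = T u
    have h1 : S (S (MulOpposite.op unitJ • u)) = MulOpposite.op unitJ • T u := by
      rw [← map_smul T]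
      exact congrArg (fun A : E →L[ℂ] E => A (MulOpposite.op unitJ • u)) hSS
    rw [hS'apply, hS'apply, smul_neg, hjj, neg_neg, h1, hjj, neg_neg]
  have hSS' : S = S' := CFC.sqrt_unique hS'S' hS'0
  have hScomm : ∀ u, S (MulOpposite.op unitJ • u) = MulOpposite.op unitJ • S u := fun u => by
    conv_rhs => rw [hSS', hS'apply, smul_neg, hjj, neg_neg]
  have hPu : ∀ P : E →L[ℍ[ℝ]ᵐᵒᵖ] E, IsPositive P → P * P = T → S = toComplexOp P :=
    fun P hP hPP => CFC.sqrt_unique (by rw [← hPP]; rfl) (toComplexOp_nonneg hP)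
  refine ⟨ofComplexOp S hScomm, ⟨?_, ?_⟩, ?_⟩
  · intro u
    have hpos := hS0
    rw [ContinuousLinearMap.nonneg_iff_isPositive] at hpos
    have hre : 0 ≤ (inner ℂ u (S u)).re := hpos.re_inner_nonneg_right u
    set P := ofComplexOp S hScomm with hP
    have hPS : ∀ v, P v = S v := fun v => rfl
    have hsymm : inner ℍ[ℝ] (P u) u = inner ℍ[ℝ] u (P u) := by
      apply inner_eq_of_re
      intro q
      rw [← map_smul P, ← complex_inner_re, ← complex_inner_re, hPS, hPS]
      exact congrArg Complex.re (hpos.isSymmetric u (MulOpposite.op q • u))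
    rw [← star_inner, Quaternion.star_eq_self] at hsymm
    exact ⟨_, hre, hsymm⟩
  · ext u
    exact congrArg (fun A : E →L[ℂ] E => A u) hSS
  · rintro P ⟨hP, hPP⟩
    ext u
    exact (congrArg (fun A : E →L[ℂ] E => A u) (hPu P hP hPP)).symm

end Complex

section Operators

variable {E : Type*} [NormedAddCommGroup E] [QuaternionicInnerProductSpace E]

/-- The real normed space underlying a quaternionic inner product space: `r • u = u r`. It equips
the bounded operators with the real scalar multiplication `(r • T) u = (T u) r`. -/
instance (priority := 100) instNormedSpaceReal : NormedSpace ℝ E where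
  toModule := Module.compHom E (algebraMap ℝ ℍ[ℝ]ᵐᵒᵖ)
  norm_smul_le r u := by
    change ‖MulOpposite.op (r : ℍ[ℝ]) • u‖ ≤ _
    rw [norm_op_smul, Quaternion.norm_coe]

theorem real_smul_def (r : ℝ) (u : E) : r • u = MulOpposite.op (r : ℍ[ℝ]) • u := rfl

instance instSMulCommClassReal : SMulCommClass ℍ[ℝ]ᵐᵒᵖ ℝ E where
  smul_comm q r u := by
    rw [real_smul_def, real_smul_def, ← mul_smul, ← mul_smul]
    congr 1
    apply MulOpposite.unop_injective
    exact Quaternion.coe_commutes r q.unop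

variable [CompleteSpace E]

/-- The bounded operators form a `*`-ring, the star being the adjoint. -/
instance instStarRing : StarRing (E →L[ℍ[ℝ]ᵐᵒᵖ] E) where
  star := adjoint
  star_involutive T := by
    ext u
    apply ext_inner_right
    intro v
    rw [inner_adjoint_left, ← star_inner, inner_adjoint_left, star_inner]
  star_mul S T := by
    ext u
    apply ext_inner_right
    intro v
    rw [inner_adjoint_left]
    change inner ℍ[ℝ] u (S (T v)) = inner ℍ[ℝ] (adjoint T (adjoint S u)) v
    rw [inner_adjoint_left, inner_adjoint_left]
  star_add S T := by
    ext u
    apply ext_inner_right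
    intro v
    rw [inner_adjoint_left]
    change inner ℍ[ℝ] u (S v + T v) = inner ℍ[ℝ] (adjoint S u + adjoint T u) v
    rw [inner_add_right, inner_add_left, inner_adjoint_left, inner_adjoint_left]

theorem inner_star_left (T : E →L[ℍ[ℝ]ᵐᵒᵖ] E) (u v : E) :
    inner ℍ[ℝ] (star T u) v = inner ℍ[ℝ] u (T v) :=
  inner_adjoint_left T u v

theorem isPositive_star_mul_self (T : E →L[ℍ[ℝ]ᵐᵒᵖ] E) : IsPositive (star T * T) := fun u =>
  ⟨‖T u‖ ^ 2, sq_nonneg _, by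
    rw [← inner_self, ← star_inner]
    change star (inner ℍ[ℝ] (star T (T u)) u) = _
    rw [inner_star_left, star_inner]⟩

/-- The absolute value `|T| = √(T* T)`, the unique positive square root of `T* T`. -/
def absOp (T : E →L[ℍ[ℝ]ᵐᵒᵖ] E) : E →L[ℍ[ℝ]ᵐᵒᵖ] E :=
  (existsUnique_sqrt (isPositive_star_mul_self T)).choose

theorem absOp_spec (T : E →L[ℍ[ℝ]ᵐᵒᵖ] E) :
    IsPositive (absOp T) ∧ absOp T * absOp T = star T * T :=
  (existsUnique_sqrt (isPositive_star_mul_self T)).choose_spec.1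

theorem absOp_unique {T P : E →L[ℍ[ℝ]ᵐᵒᵖ] E} (hP : IsPositive P) (h : P * P = star T * T) :
    P = absOp T :=
  (existsUnique_sqrt (isPositive_star_mul_self T)).choose_spec.2 P ⟨hP, h⟩

/-- The orthogonal complement `{v | ⟨v|u⟩ = 0 for all u ∈ S}`. -/
def orthogonalComplement (S : Set E) : Set E :=
  {v | ∀ u ∈ S, inner ℍ[ℝ] v u = 0}

/-- The real part `A = (T + T*) 1/2` of a bounded operator. -/
def selfAdjointPart (T : E →L[ℍ[ℝ]ᵐᵒᵖ] E) : E →L[ℍ[ℝ]ᵐᵒᵖ] E :=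
  (1 / 2 : ℝ) • (T + star T)

/-- The operator `B = |T - T*| 1/2`. -/
def absImaginaryPart (T : E →L[ℍ[ℝ]ᵐᵒᵖ] E) : E →L[ℍ[ℝ]ᵐᵒᵖ] E :=
  (1 / 2 : ℝ) • absOp (T - star T)

/-- `J` is an anti self-adjoint unitary operator commuting with `T` and `T*` such that
`T = (T + T*) 1/2 + J |T - T*| 1/2`. -/
structure IsImaginaryUnitFor (T J : E →L[ℍ[ℝ]ᵐᵒᵖ] E) : Prop where
  star_eq_neg : star J = -J
  mem_unitary : J ∈ unitary (E →L[ℍ[ℝ]ᵐᵒᵖ] E)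
  commute : Commute T J
  commute_star : Commute (star T) J
  eq_add : T = selfAdjointPart T + J * absImaginaryPart T

/-- `T = A + J B` with `A` self-adjoint, `B` positive, `J` anti self-adjoint and unitary, and
`A`, `B`, `J` mutually commuting. -/
structure IsSliceDecomposition (T A B J : E →L[ℍ[ℝ]ᵐᵒᵖ] E) : Prop where
  eq_add : T = A + J * B
  isSelfAdjoint : IsSelfAdjoint A
  isPositive : IsPositive B
  star_eq_neg : star J = -J
  mem_unitary : J ∈ unitary (E →L[ℍ[ℝ]ᵐᵒᵖ] E)
  commute_A_B : Commute A B
  commute_A_J : Commute A J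
  commute_B_J : Commute B J

end Operators

end QuaternionicInnerProductSpace

end

/-! Write `T = A + C` with `C = (T - T*)/2` anti self-adjoint. Normality makes `A`, `C` and `B =
|C|` commute, since each of them commutes with `T` and `T*`. Then `‖Cx‖ = ‖Bx‖`, so `Bx ↦ Cx` is an
isometry on `Ran B`, whose closure is `(Ker C)^⊥`. This forces `J` there and makes it anti
self-adjoint and compatible with `A` and `C`.

On `N = Ker C` nothing is prescribed, but an anti self-adjoint unitary `K` commuting with the
restriction of `A` is still needed. It comes from `exists_skew_unitary_commute`. By Zorn
(`exists_real_total_set`) there is a total, `A`-stable set `S` of vectors with real mutual scalar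
products. "Left multiplication by `i` relative to `S`", that is `⟨v|Ku⟩ = i⟨v|u⟩` for `v ∈ S`, is
then a right linear operator. It commutes with `A` because `S` is `A`-stable. No spectral theorem is
used. `exists_skew_unitary_polar` glues the two pieces by density.

Uniqueness is algebraic: `T - T* = 2JB` with `J` unitary commuting with `B` makes `2B` the positive
root of `(T - T*)*(T - T*)`, and `JB = J'B` determines `J` on the closure of `Ran B`. -/

noncomputable section

namespace QuaternionicInnerProductSpace


/-! ### Positive operators: commutation with square roots, and self-adjointness. -/

section AbsCommute

variable {E : Type*} [NormedAddCommGroup E] [QuaternionicInnerProductSpace E] [CompleteSpace E]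

attribute [local instance] complexInnerProductSpace in
/-- An operator that commutes with the square of a positive operator commutes with the operator. -/
theorem IsPositive.commute_of_commute_mul_self {P X : E →L[ℍ[ℝ]ᵐᵒᵖ] E} (hP : IsPositive P)
    (h : Commute (P * P) X) : Commute P X := by
  have hc : Commute (toComplexOp (P * P)) (toComplexOp X) := by
    ext u
    exact congrArg (fun A : E →L[ℍ[ℝ]ᵐᵒᵖ] E => A u) h.eq
  -- Uniqueness of the positive root makes `P` a continuous function of `P * P`, and the functional
  -- calculus preserves commutation.
  have hs : CFC.sqrt (toComplexOp (P * P)) = toComplexOp P :=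
    CFC.sqrt_unique rfl (toComplexOp_nonneg hP)
  have h2 : Commute (toComplexOp P) (toComplexOp X) := by
    rw [← hs]
    exact hc.cfcₙ_nnreal _
  ext u
  exact congrArg (fun A : E →L[ℂ] E => A u) h2.eq

theorem commute_absOp {S X : E →L[ℍ[ℝ]ᵐᵒᵖ] E} (h : Commute (star S * S) X) :
    Commute (absOp S) X :=
  (absOp_spec S).1.commute_of_commute_mul_self (by rwa [(absOp_spec S).2])

theorem inner_star_right (T : E →L[ℍ[ℝ]ᵐᵒᵖ] E) (u v : E) :
    inner ℍ[ℝ] u (star T v) = inner ℍ[ℝ] (T u) v := by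
  rw [← star_inner, inner_star_left, star_inner]

theorem star_eq_of_inner {S T : E →L[ℍ[ℝ]ᵐᵒᵖ] E}
    (h : ∀ u v, inner ℍ[ℝ] (S u) v = inner ℍ[ℝ] u (T v)) : star T = S := by
  ext u
  apply ext_inner_right
  intro v
  rw [inner_star_left, h]

-- Complex positivity gives symmetry for the complex scalar product. Its real part, tested on all
-- right multiples `v q`, recovers the full quaternionic identity.
attribute [local instance] complexInnerProductSpace in
theorem IsPositive.isSelfAdjoint {P : E →L[ℍ[ℝ]ᵐᵒᵖ] E} (hP : IsPositive P) :
    IsSelfAdjoint P := by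
  have hpos := toComplexOp_nonneg hP
  rw [ContinuousLinearMap.nonneg_iff_isPositive] at hpos
  refine star_eq_of_inner fun u v => inner_eq_of_re fun q => ?_
  rw [← map_smul P, ← complex_inner_re, ← complex_inner_re]
  exact congrArg Complex.re (hpos.isSymmetric u (MulOpposite.op q • v))

end AbsCommute

/-! ### Quaternionic units and left multiplication by `i`. -/

section Units

/-- The quaternionic unit `i`. -/
def unitI : ℍ[ℝ] := ⟨0, 1, 0, 0⟩

theorem unitI_re : unitI.re = 0 := rfl

theorem unitI_imI : unitI.imI = 1 := rfl

theorem unitI_imJ : unitI.imJ = 0 := rfl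

theorem unitI_imK : unitI.imK = 0 := rfl

/-- The quaternionic unit `k`. -/
def unitK : ℍ[ℝ] := ⟨0, 0, 0, 1⟩

theorem unitK_re : unitK.re = 0 := rfl

theorem unitK_imI : unitK.imI = 0 := rfl

theorem unitK_imJ : unitK.imJ = 0 := rfl

theorem unitK_imK : unitK.imK = 1 := rfl

theorem unitI_mul_self : unitI * unitI = -1 := by
  ext <;> simp [unitI_re, unitI_imI, unitI_imJ, unitI_imK]

theorem star_unitI : star unitI = -unitI := by
  ext <;> simp [unitI_re, unitI_imI, unitI_imJ, unitI_imK]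

/-- Expresses left multiplication by `i` through real parts of right multiples of `q` only. Those
are what a real orthogonal projection can produce, so this identity dictates the formula for `f` in
`exists_skew_unitary_commute`. -/
theorem unitI_mul_eq (q : ℍ[ℝ]) :
    (q.re : ℍ[ℝ]) * unitI + ((q * unitI).re : ℍ[ℝ]) - ((q * unitJ).re : ℍ[ℝ]) * unitK +
      ((q * unitK).re : ℍ[ℝ]) * unitJ = unitI * q := by
  ext <;> simp [unitI_re, unitI_imI, unitI_imJ, unitI_imK, unitJ_re, unitJ_imI, unitJ_imJ, unitJ_imK, unitK_re, unitK_imI, unitK_imJ, unitK_imK]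

end Units

/-! ### The underlying real Hilbert space and an imaginary unit commuting with a self-adjoint
operator. -/

section Real

variable (E : Type*) [NormedAddCommGroup E] [QuaternionicInnerProductSpace E]

instance : NormedDivisionRing ℍ[ℝ]ᵐᵒᵖ where
  __ := MulOpposite.instDivisionRing
  __ := MulOpposite.instNormedRing
  norm_mul a b := by
    rw [← MulOpposite.norm_unop, MulOpposite.unop_mul, norm_mul, mul_comm]; rfl

instance : IsBoundedSMul ℍ[ℝ]ᵐᵒᵖ E :=
  IsBoundedSMul.of_norm_smul_le fun q u => (norm_op_smul q.unop u).le

/-- The real inner product space underlying a quaternionic inner product space. -/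
@[reducible] def realInnerProductSpace : InnerProductSpace ℝ E where
  toNormedSpace := instNormedSpaceReal
  inner u v := (inner ℍ[ℝ] u v).re
  norm_sq_eq_re_inner u := by rw [inner_self]; exact (Quaternion.re_coe _).symm
  conj_inner_symm u v := by rw [← star_inner u v]; simp
  add_left u v w := by rw [inner_add_left]; simp
  smul_left u v r := by
    rw [real_smul_def, inner_smul_left]; simp

variable {E}

attribute [local instance] realInnerProductSpace

theorem real_inner_def (u v : E) : inner ℝ u v = (inner ℍ[ℝ] u v).re := rfl

theorem inner_zero_right (u : E) : inner ℍ[ℝ] u (0 : E) = 0 := by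
  have := inner_smul_right u (0 : E) 0
  simpa using this

theorem inner_neg_right (u v : E) : inner ℍ[ℝ] u (-v) = -inner ℍ[ℝ] u v := by
  have := inner_smul_right u v (-1)
  simpa using this

theorem inner_sub_right (u v w : E) :
    inner ℍ[ℝ] u (v - w) = inner ℍ[ℝ] u v - inner ℍ[ℝ] u w := by
  rw [sub_eq_add_neg, inner_add_right, inner_neg_right, sub_eq_add_neg]

theorem eq_zero_of_inner_self {u : E} (h : inner ℍ[ℝ] u u = 0) : u = 0 := by
  rw [inner_self] at h
  have h2 : ‖u‖ ^ 2 = 0 := Quaternion.coe_injective (h.trans Quaternion.coe_zero.symm)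
  simpa using h2

/-- The real subspace of the vectors that have real scalar products with all elements of `S`. -/
def realCommutant (S : Set E) : Submodule ℝ E where
  carrier := {x | ∀ v ∈ S, inner ℍ[ℝ] v x = inner ℍ[ℝ] x v}
  add_mem' {x y} hx hy v hv := by rw [inner_add_right, inner_add_left, hx v hv, hy v hv]
  zero_mem' v hv := by
    rw [← star_inner 0 v, inner_zero_right, star_zero]
  smul_mem' r x hx v hv := by
    rw [real_smul_def, inner_smul_right, inner_smul_left, hx v hv, Quaternion.star_coe,
      Quaternion.coe_commutes]

/-- An equality of quaternionic scalar products amounts to equalities of real parts for all right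
multiples, and each of these is a closed condition on `x`. -/
theorem isClosed_realCommutant (S : Set E) : IsClosed (realCommutant S : Set E) := by
  have : (realCommutant S : Set E) = {x | ∀ v ∈ S, ∀ q : ℍ[ℝ],
      inner ℝ v (MulOpposite.op q • x) = inner ℝ x (MulOpposite.op q • v)} := by
    ext x
    refine forall₂_congr fun v hv => ⟨fun h q => ?_, fun h => inner_eq_of_re h⟩
    rw [real_inner_def, real_inner_def, inner_smul_right, inner_smul_right, h]
  rw [this]
  simp only [Set.ofPred_forall]
  refine isClosed_iInter fun v => isClosed_iInter fun _ => isClosed_iInter fun q => ?_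
  exact isClosed_eq (by fun_prop) (by fun_prop)

variable [CompleteSpace E]

/-- A maximal set of vectors with real mutual scalar products that is stable under a self-adjoint
operator is total. -/
theorem exists_real_total_set {A : E →L[ℍ[ℝ]ᵐᵒᵖ] E} (hA : IsSelfAdjoint A) :
    ∃ S : Set E, (∀ v ∈ S, A v ∈ S) ∧
      (∀ v ∈ S, ∀ w ∈ S, inner ℍ[ℝ] v w = inner ℍ[ℝ] w v) ∧
      ∀ u, (∀ v ∈ S, inner ℍ[ℝ] v u = 0) → u = 0 := by
  have hAs : ∀ u v, inner ℍ[ℝ] (A u) v = inner ℍ[ℝ] u (A v) := fun u v => by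
    conv_lhs => rw [← hA.star_eq, inner_star_left]
  obtain ⟨S, hS⟩ := zorn_subset {S : Set E | (∀ v ∈ S, A v ∈ S) ∧
      ∀ v ∈ S, ∀ w ∈ S, inner ℍ[ℝ] v w = inner ℍ[ℝ] w v} (by
    intro c hc hchain
    refine ⟨⋃₀ c, ⟨?_, ?_⟩, fun s hs => Set.subset_sUnion_of_mem hs⟩
    · rintro v ⟨s, hs, hv⟩
      exact ⟨s, hs, (hc hs).1 v hv⟩
    · rintro v ⟨s, hs, hv⟩ w ⟨t, ht, hw⟩
      obtain hst | hst := hchain.total hs ht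
      · exact (hc ht).2 v (hst hv) w hw
      · exact (hc hs).2 v hv w (hst hw))
  refine ⟨S, hS.prop.1, hS.prop.2, fun u hu => ?_⟩
  have hpow : ∀ (n : ℕ) (v w : E), inner ℍ[ℝ] (A^[n] v) w = inner ℍ[ℝ] v (A^[n] w) := by
    intro n
    induction n with
    | zero => intro v w; rfl
    | succ n ih =>
      intro v w
      rw [Function.iterate_succ_apply', hAs, ih, Function.iterate_succ_apply]
  have hSpow : ∀ (n : ℕ), ∀ v ∈ S, A^[n] v ∈ S := by
    intro n
    induction n with
    | zero => intro v hv; exact hv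
    | succ n ih =>
      intro v hv
      rw [Function.iterate_succ_apply']
      exact hS.prop.1 _ (ih v hv)
  have hort : ∀ v ∈ S, ∀ n : ℕ, inner ℍ[ℝ] v (A^[n] u) = 0 := fun v hv n => by
    rw [← hpow, hu _ (hSpow n v hv)]
  have hort' : ∀ v ∈ S, ∀ n : ℕ, inner ℍ[ℝ] (A^[n] u) v = 0 := fun v hv n => by
    rw [← star_inner, hort v hv n, star_zero]
  -- If `u ⊥ S`, adjoining the whole orbit `A^n u` keeps the set admissible. Maximality then puts
  -- `u` in `S`, so `u` is orthogonal to itself.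
  have hmem : S ∪ Set.range (fun n : ℕ => A^[n] u) ∈ {S : Set E | (∀ v ∈ S, A v ∈ S) ∧
      ∀ v ∈ S, ∀ w ∈ S, inner ℍ[ℝ] v w = inner ℍ[ℝ] w v} := by
    refine ⟨?_, ?_⟩
    · rintro v (hv | ⟨n, rfl⟩)
      · exact Or.inl (hS.prop.1 v hv)
      · exact Or.inr ⟨n + 1, Function.iterate_succ_apply' _ _ _⟩
    · rintro v (hv | ⟨n, rfl⟩) w (hw | ⟨m, rfl⟩)
      · exact hS.prop.2 v hv w hw
      · exact (hort v hv m).trans (hort' v hv m).symm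
      · exact (hort' w hw n).trans (hort w hw n).symm
      -- Both sides equal `⟨u|A^(n+m) u⟩`.
      · change inner ℍ[ℝ] (A^[n] u) (A^[m] u) = inner ℍ[ℝ] (A^[m] u) (A^[n] u)
        rw [hpow, hpow m, ← Function.iterate_add_apply, ← Function.iterate_add_apply, add_comm]
  have huS : u ∈ S := hS.le_of_ge hmem Set.subset_union_left (Or.inr ⟨0, rfl⟩)
  exact eq_zero_of_inner_self (hu u huS)

/-- For a self-adjoint operator there is an anti self-adjoint unitary operator commuting with it. -/
theorem exists_skew_unitary_commute {A : E →L[ℍ[ℝ]ᵐᵒᵖ] E} (hA : IsSelfAdjoint A) :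
    ∃ J : E →L[ℍ[ℝ]ᵐᵒᵖ] E, star J = -J ∧ J * J = -1 ∧ Commute A J := by
  obtain ⟨S, hSA, hSr, hS0⟩ := exists_real_total_set hA
  have hsep : ∀ x y : E, (∀ v ∈ S, inner ℍ[ℝ] v x = inner ℍ[ℝ] v y) → x = y := fun x y h =>
    sub_eq_zero.1 (hS0 _ fun v hv => by rw [inner_sub_right, h v hv, sub_self])
  let V := realCommutant S
  have : CompleteSpace V := (isClosed_realCommutant S).completeSpace_coe
  -- The real orthogonal projection onto `V` takes real parts of the coordinates `⟨v|x⟩`: the left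
  -- side is real because the projection lies in `V`, and the real parts agree because `v` itself
  -- lies in `V`.
  have hP : ∀ v ∈ S, ∀ x : E, inner ℍ[ℝ] v (V.starProjection x) =
      ((inner ℍ[ℝ] v x).re : ℍ[ℝ]) := by
    intro v hv x
    have hvV : v ∈ V := fun w hw => hSr w hw v hv
    have h1 : inner ℍ[ℝ] v (V.starProjection x) = inner ℍ[ℝ] (V.starProjection x) v :=
      V.starProjection_apply_mem x v hv
    rw [← star_inner, Quaternion.star_eq_self] at h1
    have h2 : inner ℝ v (V.starProjection x) = inner ℝ v x := by
      rw [← Submodule.inner_starProjection_left_eq_right,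
        Submodule.starProjection_eq_self_iff.2 hvV]
    rw [← star_inner, h1, Quaternion.star_coe]
    congr 1
    rw [← real_inner_def, ← real_inner_def, real_inner_comm, h2]
  let R : ℍ[ℝ] → E → E := fun q u => MulOpposite.op q • u
  let P : E → E := V.starProjection
  -- Chosen so that pairing with `v ∈ S` gives the left side of `unitI_mul_eq` for `q = ⟨v|u⟩`.
  -- Totality of `S` then yields right linearity, although `P` is only real linear.
  let f : E → E := fun u => R unitI (P u) + P (R unitI u) - R unitK (P (R unitJ u)) + R unitJ (P (R unitK u))
  have hf : ∀ v ∈ S, ∀ u, inner ℍ[ℝ] v (f u) = unitI * inner ℍ[ℝ] v u := by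
    intro v hv u
    simp only [f, R, P, inner_add_right, inner_sub_right, inner_smul_right, hP v hv]
    exact unitI_mul_eq _
  -- On `S` itself left and right multiplication by `i` agree, since the scalar products are real;
  -- this gives the adjoint of `J`.
  have hfS : ∀ v ∈ S, f v = MulOpposite.op unitI • v := by
    intro v hv
    apply hsep
    intro w hw
    have h := hSr w hw v hv
    rw [← star_inner, Quaternion.star_eq_self] at h
    rw [hf w hw, inner_smul_right, ← star_inner, h, Quaternion.star_coe, Quaternion.coe_commutes]
  have hfc : Continuous f := by
    have hPc : Continuous P := V.starProjection.continuous
    have hR : ∀ q, Continuous (R q) := fun q => continuous_const_smul _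
    exact ((((hR unitI).comp hPc).add (hPc.comp (hR unitI))).sub
      ((hR unitK).comp (hPc.comp (hR unitJ)))).add ((hR unitJ).comp (hPc.comp (hR unitK)))
  let J : E →L[ℍ[ℝ]ᵐᵒᵖ] E :=
    { toFun := f
      map_add' := fun x y => hsep _ _ fun v hv => by
        rw [hf v hv, inner_add_right, inner_add_right, hf v hv, hf v hv, mul_add]
      map_smul' := fun q x => hsep _ _ fun v hv => by
        have e := inner_smul_right v x q.unop
        have e' := inner_smul_right v (f x) q.unop
        rw [MulOpposite.op_unop] at e e'
        rw [hf v hv, RingHom.id_apply, e, e', hf v hv, mul_assoc]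
      cont := hfc }
  have hJ : ∀ v ∈ S, ∀ u, inner ℍ[ℝ] v (J u) = unitI * inner ℍ[ℝ] v u := hf
  refine ⟨J, ?_, ?_, ?_⟩
  · ext u
    refine hsep _ _ fun v hv => ?_
    rw [inner_star_right]
    change inner ℍ[ℝ] (f v) u = inner ℍ[ℝ] v (-(J u))
    rw [hfS v hv, inner_smul_left, inner_neg_right, hJ v hv, star_unitI, neg_mul]
  · ext u
    refine hsep _ _ fun v hv => ?_
    change inner ℍ[ℝ] v (J (J u)) = inner ℍ[ℝ] v (-u)
    rw [hJ v hv, hJ v hv, ← mul_assoc, unitI_mul_self, inner_neg_right, neg_one_mul]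
  · ext u
    refine hsep _ _ fun v hv => ?_
    change inner ℍ[ℝ] v (A (J u)) = inner ℍ[ℝ] v (J (A u))
    have hAs : ∀ w, inner ℍ[ℝ] (A v) w = inner ℍ[ℝ] v (A w) := fun w => by
      conv_lhs => rw [← hA.star_eq, inner_star_left]
    -- The stability `A v ∈ S` enters here: the formula for `J` may be applied against `A v`.
    rw [← hAs, hJ _ (hSA v hv), hJ v hv, hAs]

end Real


/-! ### Polar decomposition with an anti self-adjoint unitary factor. -/

section Polar

variable {E : Type*} [NormedAddCommGroup E] [QuaternionicInnerProductSpace E]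

/-- Allows `exists_skew_unitary_commute` to be applied inside the kernel of `C`. -/
instance (N : Submodule ℍ[ℝ]ᵐᵒᵖ E) : QuaternionicInnerProductSpace N where
  toModule := N.module
  inner u v := inner ℍ[ℝ] (u : E) v
  inner_add_right u v w := inner_add_right (u : E) v w
  inner_smul_right u v q := inner_smul_right (u : E) v q
  star_inner u v := star_inner (u : E) v
  inner_self u := inner_self (u : E)

theorem norm_eq_of_inner_self {u v : E} (h : inner ℍ[ℝ] u u = inner ℍ[ℝ] v v) : ‖u‖ = ‖v‖ := by
  rw [inner_self, inner_self] at h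
  exact (sq_eq_sq₀ (norm_nonneg _) (norm_nonneg _)).1 (Quaternion.coe_injective h)

variable [CompleteSpace E]

/-- On a closed subspace that is stable under a self-adjoint operator there is an isometric anti
self-adjoint operator commuting with it. -/
theorem exists_skew_isometry_on {A : E →L[ℍ[ℝ]ᵐᵒᵖ] E} (hA : IsSelfAdjoint A)
    {N : Submodule ℍ[ℝ]ᵐᵒᵖ E} (hN : IsClosed (N : Set E)) (hAN : ∀ u ∈ N, A u ∈ N) :
    ∃ J : N →ₗ[ℍ[ℝ]ᵐᵒᵖ] N,
      (∀ x y : N, inner ℍ[ℝ] (J x : E) (J y : E) = inner ℍ[ℝ] (x : E) (y : E)) ∧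
      (∀ x y : N, inner ℍ[ℝ] (J x : E) (y : E) = -inner ℍ[ℝ] (x : E) (J y : E)) ∧
      ∀ x : N, (J ⟨A x, hAN x x.2⟩ : E) = A (J x) := by
  have : CompleteSpace N := hN.completeSpace_coe
  let A' : N →L[ℍ[ℝ]ᵐᵒᵖ] N := (A.comp N.subtypeL).codRestrict N fun x => hAN x x.2
  have hA' : IsSelfAdjoint A' := star_eq_of_inner fun u v => by
    change inner ℍ[ℝ] (A (u : E)) (v : E) = inner ℍ[ℝ] (u : E) (A (v : E))
    conv_lhs => rw [← hA.star_eq, inner_star_left]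
  obtain ⟨J, hJs, hJJ, hAJ⟩ := exists_skew_unitary_commute hA'
  have hskew : ∀ x y : N, inner ℍ[ℝ] (J x) y = -inner ℍ[ℝ] x (J y) := fun x y => by
    rw [← inner_star_right, hJs, ← inner_neg_right]; rfl
  have hJJ' : ∀ x, J (J x) = -x := fun x => congrArg (fun S : N →L[ℍ[ℝ]ᵐᵒᵖ] N => S x) hJJ
  refine ⟨J, fun x y => ?_, hskew, fun x => ?_⟩
  · change inner ℍ[ℝ] (J x) (J y) = inner ℍ[ℝ] x y
    rw [hskew, hJJ', inner_neg_right, neg_neg]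
  · exact congrArg (fun S : N →L[ℍ[ℝ]ᵐᵒᵖ] N => ((S x : N) : E)) hAJ.eq.symm

-- A vector `u` orthogonal to `Ran B` satisfies `B u = 0`, hence lies in `N`; being also orthogonal
-- to `N`, it vanishes. Real orthogonality suffices, since the range is a real subspace.
attribute [local instance] realInnerProductSpace in
theorem denseRange_add_ker {B : E →L[ℍ[ℝ]ᵐᵒᵖ] E} (hB : IsSelfAdjoint B)
    {N : Submodule ℍ[ℝ]ᵐᵒᵖ E} (hN : ∀ u, B u = 0 → u ∈ N) :
    DenseRange (B.toLinearMap.coprod N.subtype) := by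
  let R : Submodule ℝ E :=
    { carrier := Set.range (B.toLinearMap.coprod N.subtype)
      add_mem' := by
        rintro _ _ ⟨x, rfl⟩ ⟨y, rfl⟩
        exact ⟨x + y, map_add _ _ _⟩
      zero_mem' := ⟨0, map_zero _⟩
      smul_mem' := by
        rintro r _ ⟨x, rfl⟩
        exact ⟨MulOpposite.op (r : ℍ[ℝ]) • x, map_smul _ _ _⟩ }
  have hR : R.topologicalClosure = ⊤ := by
    rw [Submodule.topologicalClosure_eq_top_iff, Submodule.eq_bot_iff]
    intro u hu
    have hu' : ∀ x : E × N, inner ℝ (B x.1 + (x.2 : E)) u = 0 := fun x => hu _ ⟨x, rfl⟩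
    have hBu : B u = 0 := by
      apply inner_self_eq_zero (𝕜 := ℝ).1
      have h := hu' (B u, 0)
      rw [Submodule.coe_zero, add_zero, real_inner_def] at h
      rwa [← inner_star_right, hB.star_eq] at h
    have h := hu' (0, ⟨u, hN u hBu⟩)
    simpa using h
  have h2 := congrArg (fun S : Submodule ℝ E => (S : Set E)) hR
  rw [Submodule.topologicalClosure_coe] at h2
  exact dense_iff_closure_eq.2 h2

/-- A bounded operator that is anti self-adjoint and commutes with the self-adjoint operator `A`
has a polar decomposition `C = J B` with `J` unitary, anti self-adjoint and commuting with `A`. -/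
theorem exists_skew_unitary_polar {A B C : E →L[ℍ[ℝ]ᵐᵒᵖ] E} (hA : IsSelfAdjoint A)
    (hB : IsSelfAdjoint B) (hC : star C = -C) (hBB : B * B = star C * C) (hAB : Commute A B)
    (hAC : Commute A C) (hBC : Commute B C) :
    ∃ J : E →L[ℍ[ℝ]ᵐᵒᵖ] E, star J = -J ∧ J ∈ unitary (E →L[ℍ[ℝ]ᵐᵒᵖ] E) ∧ Commute A J ∧
      Commute C J ∧ C = J * B := by
  have hAB' : ∀ x, A (B x) = B (A x) := fun x => congrArg (fun S : E →L[ℍ[ℝ]ᵐᵒᵖ] E => S x) hAB.eq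
  have hAC' : ∀ x, A (C x) = C (A x) := fun x => congrArg (fun S : E →L[ℍ[ℝ]ᵐᵒᵖ] E => S x) hAC.eq
  have hBC' : ∀ x, B (C x) = C (B x) := fun x => congrArg (fun S : E →L[ℍ[ℝ]ᵐᵒᵖ] E => S x) hBC.eq
  have hBs : ∀ x y, inner ℍ[ℝ] (B x) y = inner ℍ[ℝ] x (B y) := fun x y => by
    conv_lhs => rw [← hB.star_eq, inner_star_left]
  have hCs : ∀ x y, inner ℍ[ℝ] (C x) y = -inner ℍ[ℝ] x (C y) := fun x y => by
    rw [← inner_star_right, hC, ← inner_neg_right]; rfl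
  have hCB : ∀ x y, inner ℍ[ℝ] (C x) (C y) = inner ℍ[ℝ] (B x) (B y) := fun x y => by
    rw [hBs, ← inner_star_right]
    exact congrArg (fun S : E →L[ℍ[ℝ]ᵐᵒᵖ] E => inner ℍ[ℝ] x (S y)) hBB.symm
  have hker : ∀ x, C x = 0 ↔ B x = 0 := fun x => by
    rw [← norm_eq_zero, norm_eq_of_inner_self (hCB x x), norm_eq_zero]
  let N : Submodule ℍ[ℝ]ᵐᵒᵖ E := LinearMap.ker C.toLinearMap
  have hN : ∀ u, u ∈ N ↔ C u = 0 := fun u => LinearMap.mem_ker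
  obtain ⟨K, hKK, hKs, hKA⟩ := exists_skew_isometry_on hA (N := N)
    (isClosed_singleton.preimage C.continuous) (fun u hu => by
      rw [hN] at hu ⊢
      rw [← hAC', hu, map_zero])
  have hCN : ∀ x : N, C x = 0 := fun x => (hN x).1 x.2
  have hBN : ∀ x : N, B x = 0 := fun x => (hker x).1 (hCN x)
  -- `J` is to send `e (x, n) = Bx + n` to `f (x, n) = Cx + Kn`. Equality of scalar products (`hff`)
  -- makes this a well-defined isometry on a dense subspace, so it extends to `E`.
  let e : E × N →ₗ[ℍ[ℝ]ᵐᵒᵖ] E := B.toLinearMap.coprod N.subtype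
  let f : E × N →ₗ[ℍ[ℝ]ᵐᵒᵖ] E := C.toLinearMap.coprod (N.subtype.comp K)
  have hd : DenseRange e := denseRange_add_ker hB fun u hu => (hN u).2 ((hker u).2 hu)
  have hCort : ∀ (x : E) (y : N), inner ℍ[ℝ] (C x) (y : E) = 0 := fun x y => by
    rw [hCs, hCN, inner_zero_right, neg_zero]
  have hCort' : ∀ (x : E) (y : N), inner ℍ[ℝ] (y : E) (C x) = 0 := fun x y => by
    rw [← star_inner, hCort, star_zero]
  have hBort : ∀ (x : E) (y : N), inner ℍ[ℝ] (B x) (y : E) = 0 := fun x y => by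
    rw [hBs, hBN, inner_zero_right]
  have hBort' : ∀ (x : E) (y : N), inner ℍ[ℝ] (y : E) (B x) = 0 := fun x y => by
    rw [← star_inner, hBort, star_zero]
  have hff : ∀ x y, inner ℍ[ℝ] (f x) (f y) = inner ℍ[ℝ] (e x) (e y) := by
    rintro ⟨x, u⟩ ⟨y, v⟩
    change inner ℍ[ℝ] (C x + (K u : E)) (C y + (K v : E)) =
      inner ℍ[ℝ] (B x + (u : E)) (B y + (v : E))
    simp only [inner_add_left, inner_add_right, hCort, hCort', hBort, hBort', hKK, hCB]
  have hfs : ∀ x y, inner ℍ[ℝ] (f x) (e y) = -inner ℍ[ℝ] (e x) (f y) := by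
    rintro ⟨x, u⟩ ⟨y, v⟩
    change inner ℍ[ℝ] (C x + (K u : E)) (B y + (v : E)) =
      -inner ℍ[ℝ] (B x + (u : E)) (C y + (K v : E))
    simp only [inner_add_left, inner_add_right, hCort, hCort', hBort, hBort', hKs]
    rw [hCs, ← hBC', ← hBs]
    abel
  have hnorm : ∃ c : ℝ, ∀ x, ‖f x‖ ≤ c * ‖e x‖ :=
    ⟨1, fun x => by rw [one_mul, norm_eq_of_inner_self (hff x x)]⟩
  let J : E →L[ℍ[ℝ]ᵐᵒᵖ] E := f.extendOfNorm e
  have hJe : ∀ x, J (e x) = f x := fun x => LinearMap.extendOfNorm_eq hd hnorm x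
  have hext : ∀ S S' : E →L[ℍ[ℝ]ᵐᵒᵖ] E, (∀ x, S (e x) = S' (e x)) → S = S' := fun S S' h =>
    ContinuousLinearMap.ext fun u =>
      congrFun (hd.equalizer S.continuous S'.continuous (funext h)) u
  -- Together with `hext`, this reduces every operator identity for `J` to scalar products between
  -- vectors of the form `e x`.
  have hsep : ∀ u v : E, (∀ x, inner ℍ[ℝ] (e x) u = inner ℍ[ℝ] (e x) v) → u = v := by
    intro u v h
    have h' : ∀ x : E × N, inner ℍ[ℝ] (B x.1 + (x.2 : E)) (u - v) = 0 := fun x => by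
      rw [inner_sub_right]
      exact sub_eq_zero.2 (h x)
    have hBuv : B (u - v) = 0 := eq_zero_of_inner_self (by
      rw [← hBs]
      simpa using h' (B (u - v), 0))
    refine sub_eq_zero.1 (eq_zero_of_inner_self ?_)
    simpa using h' (0, ⟨u - v, (hN _).2 ((hker _).2 hBuv)⟩)
  have hJB : ∀ x, J (B x) = C x := fun x => by
    have h := hJe (x, 0)
    simpa [e, f] using h
  have hJN : ∀ x : N, J x = K x := fun x => by
    have h := hJe (0, x)
    simpa [e, f] using h
  have hJs : star J = -J := by
    refine hext _ _ fun y => hsep _ _ fun x => ?_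
    rw [inner_star_right, hJe, hfs, ← hJe y, ← inner_neg_right]
    rfl
  have hJJ : star J * J = 1 := by
    refine hext _ _ fun y => hsep _ _ fun x => ?_
    change inner ℍ[ℝ] (e x) (star J (J (e y))) = inner ℍ[ℝ] (e x) (e y)
    rw [inner_star_right, hJe, hJe, hff]
  -- Surjectivity needs no separate argument: `J* = -J` commutes with `J`.
  have hJJ' : J * star J = 1 := by
    rw [← hJJ, hJs]
    ext u
    exact map_neg J (J u)
  refine ⟨J, hJs, ⟨hJJ, hJJ'⟩, ?_, ?_, ?_⟩
  · refine hext _ _ ?_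
    rintro ⟨x, u⟩
    change A (J (e (x, u))) = J (A (B x + u))
    rw [hJe, map_add, map_add, hAB', hJB]
    change A (C x + K u) = _
    rw [map_add, hAC', ← hKA u, ← hJN]
  · refine hext _ _ ?_
    rintro ⟨x, u⟩
    change C (J (e (x, u))) = J (C (B x + u))
    rw [hJe, map_add, hCN, add_zero, ← hBC', hJB]
    change C (C x + K u) = _
    rw [map_add, hCN, add_zero]
  · ext x
    exact (hJB x).symm

end Polar


/-! ### Existence and uniqueness of the decomposition. -/

section Main

variable {E : Type*} [NormedAddCommGroup E] [QuaternionicInnerProductSpace E]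

theorem real_smul_mul (r : ℝ) (S T : E →L[ℍ[ℝ]ᵐᵒᵖ] E) : (r • S) * T = r • (S * T) := rfl

theorem mul_real_smul (r : ℝ) (S T : E →L[ℍ[ℝ]ᵐᵒᵖ] E) : S * (r • T) = r • (S * T) := by
  ext u
  exact map_smul S (MulOpposite.op (r : ℍ[ℝ])) (T u)

theorem commute_real_smul {S T : E →L[ℍ[ℝ]ᵐᵒᵖ] E} (h : Commute S T) (r : ℝ) :
    Commute (r • S) T := by
  rw [Commute, SemiconjBy, real_smul_mul, mul_real_smul, h.eq]

theorem IsPositive.real_smul {T : E →L[ℍ[ℝ]ᵐᵒᵖ] E} (hT : IsPositive T) {r : ℝ} (hr : 0 ≤ r) :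
    IsPositive (r • T) := fun u => by
  obtain ⟨s, hs, h⟩ := hT u
  refine ⟨s * r, mul_nonneg hs hr, ?_⟩
  change inner ℍ[ℝ] u (r • T u) = _
  rw [real_smul_def, inner_smul_right, h, Quaternion.coe_mul]

variable [CompleteSpace E]

theorem star_real_smul (r : ℝ) (T : E →L[ℍ[ℝ]ᵐᵒᵖ] E) : star (r • T) = r • star T :=
  star_eq_of_inner fun u v => by
    change inner ℍ[ℝ] (r • star T u) v = inner ℍ[ℝ] u (r • T v)
    rw [real_smul_def, real_smul_def, inner_smul_left, inner_smul_right, inner_star_left,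
      Quaternion.star_coe, Quaternion.coe_commutes]

theorem isSelfAdjoint_selfAdjointPart (T : E →L[ℍ[ℝ]ᵐᵒᵖ] E) :
    IsSelfAdjoint (selfAdjointPart T) := by
  rw [IsSelfAdjoint, selfAdjointPart, star_real_smul, star_add, star_star, add_comm]

theorem isPositive_absImaginaryPart (T : E →L[ℍ[ℝ]ᵐᵒᵖ] E) :
    IsPositive (absImaginaryPart T) :=
  (absOp_spec _).1.real_smul (by norm_num)

theorem half_add_half (T : E →L[ℍ[ℝ]ᵐᵒᵖ] E) :
    T = selfAdjointPart T + (1 / 2 : ℝ) • (T - star T) := by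
  rw [selfAdjointPart, ← smul_add, add_add_sub_cancel, ← two_smul ℝ T, smul_smul]
  norm_num

theorem commute_selfAdjointPart {T X : E →L[ℍ[ℝ]ᵐᵒᵖ] E} (h : Commute T X)
    (h' : Commute (star T) X) : Commute (selfAdjointPart T) X :=
  commute_real_smul (h.add_left h') _

theorem commute_absImaginaryPart {T X : E →L[ℍ[ℝ]ᵐᵒᵖ] E} (h : Commute T X)
    (h' : Commute (star T) X) : Commute (absImaginaryPart T) X := by
  refine commute_real_smul (commute_absOp ?_) _
  rw [star_sub, star_star]
  exact (h'.sub_left h).mul_left (h.sub_left h')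

theorem absImaginaryPart_mul_self (T : E →L[ℍ[ℝ]ᵐᵒᵖ] E) :
    absImaginaryPart T * absImaginaryPart T =
      star ((1 / 2 : ℝ) • (T - star T)) * ((1 / 2 : ℝ) • (T - star T)) := by
  rw [absImaginaryPart, real_smul_mul, mul_real_smul, (absOp_spec _).2, star_real_smul,
    real_smul_mul, mul_real_smul]

theorem exists_isImaginaryUnitFor {T : E →L[ℍ[ℝ]ᵐᵒᵖ] E} (hT : IsStarNormal T) :
    ∃ J, IsImaginaryUnitFor T J := by
  set A := selfAdjointPart T with hAdef
  set C := (1 / 2 : ℝ) • (T - star T) with hCdef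
  have hTA : T = A + C := half_add_half T
  have hC : star C = -C := by
    rw [hCdef, star_real_smul, star_sub, star_star, ← neg_sub T]
    exact smul_neg _ _
  have hA := isSelfAdjoint_selfAdjointPart T
  have hTs : star T = A + -C := by rw [hTA, star_add, hC, hA.star_eq]
  have hsT : Commute (star T) T := hT.star_comm_self
  have hAT : Commute A T := commute_selfAdjointPart (Commute.refl T) hsT
  have hAT' : Commute A (star T) := commute_selfAdjointPart hsT.symm (Commute.refl _)
  have hBT : Commute (absImaginaryPart T) T := commute_absImaginaryPart (Commute.refl T) hsT
  have hBT' : Commute (absImaginaryPart T) (star T) :=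
    commute_absImaginaryPart hsT.symm (Commute.refl _)
  have hC' : ∀ X, Commute X T → Commute X (star T) → Commute X C := fun X h h' =>
    (commute_real_smul (h.sub_right h').symm _).symm
  obtain ⟨J, hJs, hJu, hAJ, hCJ, hCJB⟩ := exists_skew_unitary_polar hA
    (isPositive_absImaginaryPart T).isSelfAdjoint hC (absImaginaryPart_mul_self T)
    (commute_selfAdjointPart hBT.symm hBT'.symm) (hC' A hAT hAT') (hC' _ hBT hBT')
  refine ⟨J, hJs, hJu, ?_, ?_, ?_⟩
  · rw [hTA]
    exact hAJ.add_left hCJ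
  · rw [hTs]
    exact hAJ.add_left hCJ.neg_left
  · rw [← hCJB]
    exact hTA

theorem IsImaginaryUnitFor.isSliceDecomposition {T J : E →L[ℍ[ℝ]ᵐᵒᵖ] E} (hT : IsStarNormal T)
    (hJ : IsImaginaryUnitFor T J) :
    IsSliceDecomposition T (selfAdjointPart T) (absImaginaryPart T) J where
  eq_add := hJ.eq_add
  isSelfAdjoint := isSelfAdjoint_selfAdjointPart T
  isPositive := isPositive_absImaginaryPart T
  star_eq_neg := hJ.star_eq_neg
  mem_unitary := hJ.mem_unitary
  commute_A_B := by
    have hsT : Commute (star T) T := hT.star_comm_self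
    exact commute_selfAdjointPart (commute_absImaginaryPart (Commute.refl T) hsT).symm
      (commute_absImaginaryPart hsT.symm (Commute.refl _)).symm
  commute_A_J := commute_selfAdjointPart hJ.commute hJ.commute_star
  commute_B_J := commute_absImaginaryPart hJ.commute hJ.commute_star

/-- Commutation of `B` and `J` gives `T* = A - JB`. Adding recovers `A`; subtracting gives `T - T* =
J(2B)`, where the unitary `J` cancels in `(T - T*)*(T - T*) = (2B)²`, so `2B` is the absolute value.
-/
theorem IsSliceDecomposition.unique {T A B J : E →L[ℍ[ℝ]ᵐᵒᵖ] E}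
    (h : IsSliceDecomposition T A B J) :
    A = selfAdjointPart T ∧ B = absImaginaryPart T ∧ IsImaginaryUnitFor T J := by
  have hTs : star T = A - J * B := by
    rw [h.eq_add, star_add, star_mul, h.isSelfAdjoint.star_eq, h.isPositive.isSelfAdjoint.star_eq,
      h.star_eq_neg, sub_eq_add_neg, h.commute_B_J.neg_right.eq, neg_mul]
  have hA : A = selfAdjointPart T := by
    rw [selfAdjointPart, hTs]
    conv_rhs => rw [h.eq_add]
    rw [add_add_sub_cancel, ← two_smul ℝ A, smul_smul]
    norm_num
  have hB : B = absImaginaryPart T := by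
    have hsub : T - star T = J * ((2 : ℝ) • B) := by
      rw [hTs]
      nth_rw 1 [h.eq_add]
      rw [add_sub_sub_cancel, mul_real_smul, two_smul]
    have habs : (2 : ℝ) • B = absOp (T - star T) := by
      refine absOp_unique (h.isPositive.real_smul (by norm_num)) ?_
      rw [hsub, star_mul, star_real_smul, h.isPositive.isSelfAdjoint.star_eq, mul_assoc,
        ← mul_assoc (star J), h.mem_unitary.1, one_mul]
    rw [absImaginaryPart, ← habs, smul_smul]
    norm_num
  have hJB : Commute (J * B) J := (Commute.refl J).mul_left h.commute_B_J
  refine ⟨hA, hB, h.star_eq_neg, h.mem_unitary, ?_, ?_, ?_⟩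
  · rw [h.eq_add]
    exact h.commute_A_J.add_left hJB
  · rw [hTs]
    exact h.commute_A_J.sub_left hJB
  · rw [← hA, ← hB]
    exact h.eq_add

/-- For `D = J - J'`, the relation `DB = 0` has adjoint `BD* = 0`, so `Ran D*` lies in `Ker B ⊆
Ker(T - T*)`. Hence `⟨Du|Du⟩ = ⟨u|D*Du⟩ = 0` for `u` in the orthogonal complement. -/
theorem IsImaginaryUnitFor.eq_on_orthogonalComplement {T J J' : E →L[ℍ[ℝ]ᵐᵒᵖ] E}
    (hJ : IsImaginaryUnitFor T J) (hJ' : IsImaginaryUnitFor T J') {u : E}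
    (hu : u ∈ orthogonalComplement {v : E | (T - star T) v = 0}) : J u = J' u := by
  set B := absImaginaryPart T with hBdef
  have hBsa : IsSelfAdjoint B := (isPositive_absImaginaryPart T).isSelfAdjoint
  have hD : (J - J') * B = 0 := by
    rw [sub_mul, sub_eq_zero]
    exact add_left_cancel (hJ.eq_add.symm.trans hJ'.eq_add)
  have hD' : B * star (J - J') = 0 := by
    rw [← hBsa.star_eq, ← star_mul, hD, star_zero]
  have hker : ∀ x, B x = 0 → (T - star T) x = 0 := fun x hx => by
    have h1 : absOp (T - star T) x = 0 := by
      have h2 : absOp (T - star T) = (2 : ℝ) • B := by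
        rw [hBdef, absImaginaryPart, smul_smul]
        norm_num
      rw [h2]
      change (2 : ℝ) • B x = 0
      rw [hx, smul_zero]
    apply eq_zero_of_inner_self
    rw [← inner_star_right]
    change inner ℍ[ℝ] x ((star (T - star T) * (T - star T)) x) = 0
    rw [← (absOp_spec _).2]
    change inner ℍ[ℝ] x (absOp (T - star T) (absOp (T - star T) x)) = 0
    rw [h1, map_zero, inner_zero_right]
  have hDu : (J - J') u = 0 := by
    apply eq_zero_of_inner_self
    rw [← inner_star_right]
    exact hu _ (hker _ (congrArg (fun S : E →L[ℍ[ℝ]ᵐᵒᵖ] E => S ((J - J') u)) hD'))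
  exact sub_eq_zero.1 hDu

end Main

end QuaternionicInnerProductSpace

end
theorem mainTheorem1 {H : Type*} [NormedAddCommGroup H] [QuaternionicInnerProductSpace H]
    [CompleteSpace H] (T : H →L[ℍ[ℝ]ᵐᵒᵖ] H) (hT : IsStarNormal T) :
    -- existence of `J`
    (∃ J : H →L[ℍ[ℝ]ᵐᵒᵖ] H, QuaternionicInnerProductSpace.IsImaginaryUnitFor T J) ∧
    -- for every such `J`, `A = (T + T*) 1/2` is self-adjoint, `B = |T - T*| 1/2` is positive, and
    -- `A`, `B`, `J` commute mutually
    (∀ J : H →L[ℍ[ℝ]ᵐᵒᵖ] H, QuaternionicInnerProductSpace.IsImaginaryUnitFor T J →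
      QuaternionicInnerProductSpace.IsSliceDecomposition T
        (QuaternionicInnerProductSpace.selfAdjointPart T)
        (QuaternionicInnerProductSpace.absImaginaryPart T) J) ∧
    -- uniqueness of `A` and `B`
    (∀ A B J : H →L[ℍ[ℝ]ᵐᵒᵖ] H, QuaternionicInnerProductSpace.IsSliceDecomposition T A B J →
      A = QuaternionicInnerProductSpace.selfAdjointPart T ∧
      B = QuaternionicInnerProductSpace.absImaginaryPart T ∧
      QuaternionicInnerProductSpace.IsImaginaryUnitFor T J) ∧
    -- uniqueness of `J` on the orthogonal complement of the kernel of `T - T*`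
    (∀ J J' : H →L[ℍ[ℝ]ᵐᵒᵖ] H, QuaternionicInnerProductSpace.IsImaginaryUnitFor T J →
      QuaternionicInnerProductSpace.IsImaginaryUnitFor T J' →
      ∀ u ∈ QuaternionicInnerProductSpace.orthogonalComplement {v : H | (T - star T) v = 0},
        J u = J' u) := by
  open QuaternionicInnerProductSpace in
  exact ⟨exists_isImaginaryUnitFor hT, fun J hJ => hJ.isSliceDecomposition hT,
    fun A B J h => h.unique, fun J J' hJ hJ' u hu => hJ.eq_on_orthogonalComplement hJ' hu⟩
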